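/- Model. Let $\nu$ be a measure on $\mathbb{R}$ (written $d\nu(a)=c(a)\,da$ or $c(a)$ times counting measure in the usual canonical form), $b(\eta)=\log\int e^{\eta a}\,d\nu(a)$, and let $f_\eta$ be the canonical exponential family with density $e^{\eta a-b(\eta)}$ with respect to $\nu$; its mean function is $L^{-1}=b'$. The parameter space of the linear predictors is a closed interval $I$ inside the interior of $\{\eta:\int e^{\eta a}d\nu(a)<\infty\}$ on which the variance of $f_\eta$ is bounded. (Every compact such interval qualifies; $I=\mathbb{R}$ qualifies, so that $I$ imposes no restriction, for the Bernoulli/logistic, binomial and Gaussian families.) For each $n$ let $\boldsymbol{x}_{ij}\in\mathbb{R}^m$ $(1\le i,j\le n)$ be given covariates ($m$ fixed), $\mathcal{X}\otimes\boldsymbol\beta=[\boldsymbol{x}_{ij}^\top\boldsymbol\beta]_{n\times n}$, and let $\mathbf{A}=[A_{ij}]_{n\times n}$ have independent entries, $A_{ij}\sim f_{\eta_{ij}}$, where $\eta_{ij}=\theta_{ij}+\boldsymbol{x}_{ij}^\top\boldsymbol\beta\in I$ are the predictors of the true parameters $\mathbf{\Theta}=[\theta_{ij}]\in\mathbb{R}^{n\times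 n}$ and $\boldsymbol\beta\in\mathbb{R}^m$ (which, like the covariates, may depend on $n$). Put $\mathbf{P}=\mathbb{E}[\mathbf{A}]$. Assumptions. There are constants $K_\theta,K_\beta,K_x$ and $r$, independent of $n$, such that (A3) $\|\mathbf{\Theta}\|_{\max}\le K_\theta$ and $\mathrm{rank}(\mathbf{\Theta})\le r$; (A4) $\|\boldsymbol\beta\|_2\le K_\beta$; (A5) $\|\boldsymbol{x}_{ij}\|_2\le K_x$ for all $i,j$. Estimator. Let $s=s_n\ge r$, let $R=R_n$ satisfy $\sqrt r\,nK_\theta\le R_n\le Cn$ for a constant $C$ (in particular $R_n=\sqrt r\,nK_\theta$ is allowed), and let $B\ge K_\beta$ be a constant. Let $(\widehat{\mathbf{\Theta}},\widehat{\boldsymbol\beta})$ be any maximizer of the log-likelihood $$\ell_{\mathbf{A},\mathcal{X}}(\mathbf{\Theta}',\boldsymbol\beta')=\sum_{i,j}\big(\eta'_{ij}A_{ij}-b(\eta'_{ij})\big),\qquad \eta'_{ij}=\theta'_{ij}+\boldsymbol{x}_{ij}^\top\boldsymbol\beta',$$ (up to a term free of the parameters) over all $(\mathbf{\Theta}',\boldsymbol\beta')$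 in the parameter space, i.e. with $\|\boldsymbol\beta'\|_2\le B$ and $\eta'_{ij}\in I$ for all $i,j$, that satisfy the nuclear-norm and rank constraints $\|\mathbf{\Theta}'\|_*\le R_n$ and $\mathrm{rank}(\mathbf{\Theta}')\le s_n$. Put $\widehat{\mathbf{P}}=L^{-1}(\widehat{\mathbf{\Theta}}+\mathcal{X}\otimes\widehat{\boldsymbol\beta})$, with $L^{-1}=b'$ applied entrywise. Conclusion. $n^{-1}\|\widehat{\mathbf{P}}-\mathbf{P}\|_F\to 0$ in probability as $n\to\infty$. -/

import Mathlib

open MeasureTheory ProbabilityTheory Filter Topology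

noncomputable section

namespace LowRankGLM

/-- The log-partition function `b(η) = log ∫ exp (η a) dν(a)` of the canonical exponential family
with base measure `ν` (in the notation `c(a) exp (η a - b(η))` for a density with respect to
Lebesgue or counting measure `μ`, the base measure is `dν = c dμ`). -/
def logPartition (ν : Measure ℝ) (η : ℝ) : ℝ := cgf id ν η

/-- The member of the exponential family with natural parameter `η`: its density with respect to
`ν` is `a ↦ exp (η a - b(η))`. -/
def expFamily (ν : Measure ℝ) (η : ℝ) : Measure ℝ :=
  ν.withDensity fun a => ENNReal.ofReal (Real.exp (η * a - logPartition ν η))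

/-- The inverse of the canonical link function, `L⁻¹ = b'`. -/
def invLink (ν : Measure ℝ) (η : ℝ) : ℝ := deriv (logPartition ν) η

/-- The natural parameters `η` at which the family, and it in a neighbourhood of `η`, is defined:
the interior of `{η | ∫ exp (η a) dν(a) < ∞}`. -/
def naturalInterior (ν : Measure ℝ) : Set ℝ := interior (integrableExpSet id ν)

/-- The Frobenius norm of a real matrix. -/
def frobNorm {n : ℕ} (M : Matrix (Fin n) (Fin n) ℝ) : ℝ := √(∑ i, ∑ j, M i j ^ 2)

/-- The nuclear norm of a real square matrix: the sum of its singular values. -/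
def nuclearNorm {n : ℕ} (M : Matrix (Fin n) (Fin n) ℝ) : ℝ :=
  ∑ k ∈ Finset.range n, (Matrix.toEuclideanLin M).singularValues k

/-- The matrix of linear predictors `Θ + 𝒳 ⊗ β = Θ + ∑ₖ βₖ Xₖ`, where `x i j` is the covariate
vector of the pair `(i, j)` and `Xₖ = [x i j k]`. -/
def linPred {n m : ℕ} (x : Fin n → Fin n → EuclideanSpace ℝ (Fin m))
    (Θ : Matrix (Fin n) (Fin n) ℝ) (β : EuclideanSpace ℝ (Fin m)) : Matrix (Fin n) (Fin n) ℝ :=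
  Θ + ∑ k, β k • Matrix.of fun i j => x i j k

/-- The log-likelihood of `(Θ, β)`, that is, the logarithm of the joint density
`∏ᵢⱼ exp (ηᵢⱼ Aᵢⱼ - b(ηᵢⱼ))` with respect to the product of the base measures (it differs from
the one for a density `∏ᵢⱼ c(Aᵢⱼ) exp (ηᵢⱼ Aᵢⱼ - b(ηᵢⱼ))` by a term free of `(Θ, β)`). -/
def logLik {n m : ℕ} (ν : Measure ℝ) (x : Fin n → Fin n → EuclideanSpace ℝ (Fin m))
    (A : Matrix (Fin n) (Fin n) ℝ)
    (q : Matrix (Fin n) (Fin n) ℝ × EuclideanSpace ℝ (Fin m)) : ℝ :=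
  ∑ i, ∑ j, (linPred x q.1 q.2 i j * A i j - logPartition ν (linPred x q.1 q.2 i j))

/-- The feasible set of the rank-and-nuclear-norm constrained problem: `‖Θ‖_* ≤ R`,
`rank Θ ≤ s`, `‖β‖₂ ≤ B`, with all linear predictors in the range `I` on which the model is
considered. -/
def feasibleSet {n m : ℕ} (I : Set ℝ) (R : ℝ) (s : ℕ) (B : ℝ)
    (x : Fin n → Fin n → EuclideanSpace ℝ (Fin m)) :
    Set (Matrix (Fin n) (Fin n) ℝ × EuclideanSpace ℝ (Fin m)) :=
  {q | nuclearNorm q.1 ≤ R ∧ q.1.rank ≤ s ∧ ‖q.2‖ ≤ B ∧ ∀ i j, linPred x q.1 q.2 i j ∈ I}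

/-- `q` is a maximizer of the log-likelihood over the feasible set. -/
def IsEstimate {n m : ℕ} (ν : Measure ℝ) (I : Set ℝ) (R : ℝ) (s : ℕ) (B : ℝ)
    (x : Fin n → Fin n → EuclideanSpace ℝ (Fin m)) (A : Matrix (Fin n) (Fin n) ℝ)
    (q : Matrix (Fin n) (Fin n) ℝ × EuclideanSpace ℝ (Fin m)) : Prop :=
  q ∈ feasibleSet I R s B x ∧ IsMaxOn (logLik ν x A) (feasibleSet I R s B x) q

/-- The mean matrix `P = E[A]` of a random matrix. -/
def meanMatrix {n : ℕ} {Ω : Type*} [MeasurableSpace Ω] (μ : Measure Ω)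
    (A : Ω → Matrix (Fin n) (Fin n) ℝ) : Matrix (Fin n) (Fin n) ℝ :=
  Matrix.of fun i j => ∫ ω, A ω i j ∂μ

/-- The plug-in mean matrix `L⁻¹(Θ + 𝒳 ⊗ β)`, with `L⁻¹` applied entrywise. -/
def fittedMean {n m : ℕ} (ν : Measure ℝ) (x : Fin n → Fin n → EuclideanSpace ℝ (Fin m))
    (q : Matrix (Fin n) (Fin n) ℝ × EuclideanSpace ℝ (Fin m)) : Matrix (Fin n) (Fin n) ℝ :=
  (linPred x q.1 q.2).map (invLink ν)

end LowRankGLM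

end

/-! The true parameter is feasible, so the maximizer beats it in likelihood. Put `N = A - P`.
Rearranged, this bounds the summed Bregman divergences of `b` between fitted and true predictors by
the pairing of their difference with `N`. Since `0 ≤ b'' ≤ V` on `I`, co-coercivity
(`sq_deriv_sub_le`) bounds the squared error of the means by `2V` times that pairing
(`frobNorm_sq_fittedMean_sub_le`).

The pairing splits in two. The low-rank part is at most nuclear norm times operator norm of `N`, and
`‖N‖_op⁴ ≤ ‖NᵀN‖_F²`, whose expectation is `O(n³)` (`integral_sq_gram_le`). So `‖N‖_op =
O_p(n^{3/4})`, and a nuclear-norm radius `O(n)` contributes `O_p(n^{7/4})`. The covariate part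
consists of `m` scores of variance `O(n²)`. Both are `o_p(n²)`, and one application of Markov's
inequality to `‖NᵀN‖_F²` plus the squared scores covers them together.

The Gram bound needs uniform fourth moments although only variances are assumed bounded on `I`. As
`I` is closed, the variance bound extends slightly beyond it; this bounds the centred moment
generating functions at `±δ`, hence the fourth moments (`exists_fourth_moment_bound`). -/

namespace LowRankGLM

/-! ### Extending bounds beyond an interval; inequalities for smooth convex functions. -/

section Calculus

/-- A bound on a continuous function on a closed interval persists, up to an additive constant,
a little to the right of the interval. -/
lemma exists_bound_right_of_closed_interval {f : ℝ → ℝ} {U I : Set ℝ} (hU : IsOpen U)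
    (hf : ContinuousOn f U) (hIU : I ⊆ U) (hIc : IsClosed I) (hIo : I.OrdConnected) {V : ℝ}
    (hV : ∀ η ∈ I, f η ≤ V) :
    ∃ δ > 0, ∀ η ∈ I, ∀ t, 0 ≤ t → t ≤ δ → η + t ∈ U ∧ f (η + t) ≤ V + 1 := by
  by_cases hb : BddAbove I
  · rcases I.eq_empty_or_nonempty with rfl | hne
    · exact ⟨1, one_pos, by simp⟩
    have hM : sSup I ∈ I := hIc.csSup_mem hne hb
    have hcont : ContinuousAt f (sSup I) := hf.continuousAt (hU.mem_nhds (hIU hM))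
    have h1 : ∀ᶠ y in 𝓝 (sSup I), y ∈ U ∧ f y < V + 1 :=
      Filter.Eventually.and (hU.mem_nhds (hIU hM)) (hcont.eventually_lt_const (by linarith [hV _ hM]))
    obtain ⟨δ, hδ, h2⟩ := Metric.eventually_nhds_iff.1 h1
    refine ⟨δ / 2, by positivity, fun η hη t ht htδ => ?_⟩
    have hηM : η ≤ sSup I := le_csSup hb hη
    by_cases hle : η + t ≤ sSup I
    · have : η + t ∈ I := hIo.out hη hM ⟨by linarith, hle⟩
      exact ⟨hIU this, by linarith [hV _ this]⟩
    · have := @h2 (η + t) (by rw [Real.dist_eq, abs_lt]; constructor <;> linarith)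
      exact ⟨this.1, this.2.le⟩
  -- With no right endpoint, moving right never leaves `I`, so any `δ` works.
  · refine ⟨1, one_pos, fun η hη t ht _ => ?_⟩
    obtain ⟨y, hy, hlt⟩ := not_bddAbove_iff.1 hb (η + t)
    have : η + t ∈ I := hIo.out hη hy ⟨by linarith, hlt.le⟩
    exact ⟨hIU this, by linarith [hV _ this]⟩

/-- The left side follows from the right side by the reflection `x ↦ -x`. -/
lemma exists_bound_thickening_of_closed_interval {f : ℝ → ℝ} {U I : Set ℝ} (hU : IsOpen U)
    (hf : ContinuousOn f U) (hIU : I ⊆ U) (hIc : IsClosed I) (hIo : I.OrdConnected) {V : ℝ}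
    (hV : ∀ η ∈ I, f η ≤ V) :
    ∃ δ > 0, ∀ η ∈ I, ∀ t, |t| ≤ δ → η + t ∈ U ∧ f (η + t) ≤ V + 1 := by
  obtain ⟨δ₁, h₁, H₁⟩ := exists_bound_right_of_closed_interval hU hf hIU hIc hIo hV
  obtain ⟨δ₂, h₂, H₂⟩ := exists_bound_right_of_closed_interval (f := fun x => f (-x))
    (U := Neg.neg ⁻¹' U) (I := Neg.neg ⁻¹' I) (hU.preimage continuous_neg)
    (hf.comp continuous_neg.continuousOn fun x hx => hx) (fun x hx => hIU hx)
    (hIc.preimage continuous_neg)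
    ⟨fun x hx y hy z hz => hIo.out hy hx ⟨by linarith [hz.2], by linarith [hz.1]⟩⟩
    (V := V) fun η hη => hV _ hη
  refine ⟨min δ₁ δ₂, lt_min h₁ h₂, fun η hη t ht => ?_⟩
  obtain ⟨hl, hu⟩ := abs_le.1 ht
  rcases le_total 0 t with h0 | h0
  · exact H₁ η hη t h0 (hu.trans (min_le_left _ _))
  · have := H₂ (-η) (by simpa using hη) (-t) (by linarith) (by linarith [min_le_right δ₁ δ₂])
    have e : -(-η + -t) = η + t := by ring
    simpa only [Set.mem_preimage, e] using this

/-- First-order Taylor bound in terms of a bound on the second derivative. -/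
lemma taylor_one_le {b b' b'' : ℝ → ℝ} {u v V : ℝ}
    (hb : ∀ x ∈ Set.uIcc u v, HasDerivAt b (b' x) x)
    (hb' : ∀ x ∈ Set.uIcc u v, HasDerivAt b' (b'' x) x)
    (h0 : ∀ x ∈ Set.uIcc u v, 0 ≤ b'' x) (hV : ∀ x ∈ Set.uIcc u v, b'' x ≤ V) :
    b v - b u - b' u * (v - u) ≤ V * (v - u) ^ 2 := by
  have hcv : Convex ℝ (Set.uIcc u v) := convex_uIcc u v
  have hV0 : 0 ≤ V := (h0 u Set.left_mem_uIcc).trans (hV u Set.left_mem_uIcc)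
  -- Two uses of the mean value inequality give the constant `V` instead of the sharp `V / 2`, which
  -- suffices.
  have h1 : ∀ x ∈ Set.uIcc u v, |b' x - b' u| ≤ V * |v - u| := fun x hx => by
    have := hcv.norm_image_sub_le_of_norm_hasDerivWithin_le (f := b') (f' := b'') (C := V)
      (fun y hy => (hb' y hy).hasDerivWithinAt)
      (fun y hy => by rw [Real.norm_eq_abs, abs_of_nonneg (h0 y hy)]; exact hV y hy)
      Set.left_mem_uIcc hx
    refine this.trans ?_
    rw [Real.norm_eq_abs]
    exact mul_le_mul_of_nonneg_left (Set.abs_sub_left_of_mem_uIcc hx) hV0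
  have h2 := hcv.norm_image_sub_le_of_norm_hasDerivWithin_le (f := fun x => b x - b' u * x)
    (f' := fun x => b' x - b' u) (C := V * |v - u|)
    (fun y hy => ((hb y hy).sub (by simpa using (hasDerivAt_id y).const_mul (b' u))).hasDerivWithinAt)
    (fun y hy => h1 y hy) Set.left_mem_uIcc Set.right_mem_uIcc
  rw [Real.norm_eq_abs, Real.norm_eq_abs] at h2
  calc _ = b v - b' u * v - (b u - b' u * u) := by ring
    _ ≤ _ := le_abs_self _
    _ ≤ _ := h2
    _ = _ := by rw [mul_assoc, ← sq, sq_abs]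

/-- Co-coercivity of the derivative of a convex function with second derivative at most `V`. -/
lemma sq_deriv_sub_le {b b' b'' : ℝ → ℝ} {u v V : ℝ}
    (hb : ∀ x ∈ Set.uIcc u v, HasDerivAt b (b' x) x)
    (hb' : ∀ x ∈ Set.uIcc u v, HasDerivAt b' (b'' x) x)
    (h0 : ∀ x ∈ Set.uIcc u v, 0 ≤ b'' x) (hV : ∀ x ∈ Set.uIcc u v, b'' x ≤ V) :
    (b' v - b' u) ^ 2 ≤ 2 * V * (b v - b u - b' u * (v - u)) := by
  have hcv : Convex ℝ (Set.uIcc u v) := convex_uIcc u v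
  have hmono : MonotoneOn b' (Set.uIcc u v) :=
    monotoneOn_of_hasDerivWithinAt_nonneg hcv
      (fun x hx => (hb' x hx).continuousAt.continuousWithinAt)
      (fun x hx => (hb' x (interior_subset hx)).hasDerivWithinAt)
      (fun x hx => h0 x (interior_subset hx))
  -- `h` vanishes at `u`, and its derivative `2 (V - b'' x) (b' x - b' u)` has the sign of `x - u`
  -- because `b'` is monotone; hence `h` is nonnegative on both sides of `u`.
  set h : ℝ → ℝ := fun x => 2 * V * (b x - b u - b' u * (x - u)) - (b' x - b' u) ^ 2 with hh
  have hd : ∀ x ∈ Set.uIcc u v, HasDerivAt h (2 * (V - b'' x) * (b' x - b' u)) x := fun x hx => by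
    have e1 : HasDerivAt (fun x => b' u * (x - u)) (b' u) x := by
      simpa using ((hasDerivAt_id x).sub_const u).const_mul (b' u)
    have := ((((hb x hx).sub_const (b u)).sub e1).const_mul (2 * V)).sub
      (((hb' x hx).sub_const (b' u)).pow 2)
    refine this.congr_deriv ?_
    simp only [Nat.cast_ofNat, Nat.add_one_sub_one, pow_one]
    ring
  have hcont : ContinuousOn h (Set.uIcc u v) :=
    fun x hx => (hd x hx).continuousAt.continuousWithinAt
  have hu0 : h u = 0 := by simp [hh]
  suffices 0 ≤ h v by simpa [hh] using this
  rw [← hu0]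
  rcases le_total u v with huv | huv
  · refine monotoneOn_of_hasDerivWithinAt_nonneg hcv hcont
      (fun x hx => (hd x (interior_subset hx)).hasDerivWithinAt) (fun x hx => ?_)
      Set.left_mem_uIcc Set.right_mem_uIcc huv
    have hx' := interior_subset hx
    have := hmono Set.left_mem_uIcc hx' (by rw [Set.uIcc_of_le huv] at hx'; exact hx'.1)
    exact mul_nonneg (by linarith [hV x hx']) (by linarith)
  · refine antitoneOn_of_hasDerivWithinAt_nonpos hcv hcont
      (fun x hx => (hd x (interior_subset hx)).hasDerivWithinAt) (fun x hx => ?_)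
      Set.right_mem_uIcc Set.left_mem_uIcc huv
    have hx' := interior_subset hx
    have := hmono hx' Set.left_mem_uIcc (by rw [Set.uIcc_of_ge huv] at hx'; exact hx'.2)
    exact mul_nonpos_of_nonneg_of_nonpos (by linarith [hV x hx']) (by linarith)

end Calculus

/-! ### Cumulants and uniform fourth moments of the exponential family. -/

section ExponentialFamily

variable {ν : Measure ℝ} {η : ℝ}

lemma isOpen_naturalInterior (ν : Measure ℝ) : IsOpen (naturalInterior ν) := isOpen_interior

lemma integrable_exp_of_mem_naturalInterior (hη : η ∈ naturalInterior ν) :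
    Integrable (fun a => Real.exp (η * id a)) ν :=
  interior_subset (s := integrableExpSet id ν) hη

lemma expFamily_eq_tilted (hη : η ∈ naturalInterior ν) :
    expFamily ν η = ν.tilted (fun a => η * id a) := by
  -- For `ν = 0`, `exp (cgf)` is `1` and not the normalizer `0`, but both measures vanish.
  rcases eq_zero_or_neZero ν with rfl | hν
  · simp [expFamily]
  · unfold expFamily logPartition Measure.tilted
    congr 1
    ext a
    rw [Real.exp_sub, exp_cgf (integrable_exp_of_mem_naturalInterior hη)]
    rfl

lemma hasDerivAt_logPartition (hη : η ∈ naturalInterior ν) :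
    HasDerivAt (logPartition ν) (invLink ν η) η :=
  (analyticAt_cgf (X := id) hη).differentiableAt.hasDerivAt

lemma hasDerivAt_invLink (hη : η ∈ naturalInterior ν) :
    HasDerivAt (invLink ν) (variance id (expFamily ν η)) η := by
  rw [expFamily_eq_tilted hη, variance_tilted_mul hη, iteratedDeriv_succ, iteratedDeriv_one]
  exact (analyticAt_cgf (X := id) hη).deriv.differentiableAt.hasDerivAt

lemma continuousOn_variance_expFamily (ν : Measure ℝ) :
    ContinuousOn (fun η => variance id (expFamily ν η)) (naturalInterior ν) := by
  have h : ContinuousOn (iteratedDeriv 2 (cgf id ν)) (naturalInterior ν) := by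
    rw [show iteratedDeriv 2 (cgf id ν) = deriv (deriv (cgf id ν)) by
      rw [iteratedDeriv_succ, iteratedDeriv_one]]
    exact fun x hx => (analyticAt_cgf (X := id) hx).deriv.deriv.continuousAt.continuousWithinAt
  refine h.congr fun η hη => ?_
  rw [expFamily_eq_tilted hη, variance_tilted_mul hη]

lemma integral_expFamily (hη : η ∈ naturalInterior ν) :
    ∫ a, a ∂(expFamily ν η) = invLink ν η := by
  rw [expFamily_eq_tilted hη]
  exact integral_tilted_mul_self (X := id) hη

lemma memLp_expFamily (hη : η ∈ naturalInterior ν) (p : NNReal) :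
    MemLp id p (expFamily ν η) := by
  rw [expFamily_eq_tilted hη]
  exact memLp_tilted_mul (X := id) hη p

/-- Multiplying the density at `η` by `exp (t * a)` gives an unnormalized density at `η + t`, so the
moment generating function is a ratio of normalizers. -/
lemma exp_mul_sub_integrable_expFamily [NeZero ν] (hη : η ∈ naturalInterior ν) {t : ℝ}
    (ht : η + t ∈ naturalInterior ν) (c : ℝ) :
    Integrable (fun a => Real.exp (t * (a - c))) (expFamily ν η) ∧
    ∫ a, Real.exp (t * (a - c)) ∂(expFamily ν η)
      = Real.exp (logPartition ν (η + t) - logPartition ν η - t * c) := by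
  have hi := integrable_exp_of_mem_naturalInterior hη
  have hit := integrable_exp_of_mem_naturalInterior ht
  have key : ∀ a : ℝ, Real.exp (η * id a - logPartition ν η) * Real.exp (t * (a - c))
      = Real.exp (- logPartition ν η - t * c) * Real.exp ((η + t) * id a) := fun a => by
    rw [← Real.exp_add, ← Real.exp_add]; congr 1; simp only [id]; ring
  rw [expFamily_eq_tilted hη]
  constructor
  · rw [integrable_tilted_iff hi]
    have := hit.const_mul (Real.exp (- t * c))
    refine this.congr (ae_of_all _ fun a => ?_)
    simp only [smul_eq_mul]
    rw [← Real.exp_add, ← Real.exp_add]; congr 1; simp only [id]; ring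
  · rw [integral_tilted_mul_eq_cgf (X := id) _ hi]
    simp only [smul_eq_mul]
    have e : ∀ a : ℝ, Real.exp (η * id a - cgf id ν η) * Real.exp (t * (a - c))
      = Real.exp (- logPartition ν η - t * c) * Real.exp ((η + t) * id a) := key
    simp_rw [e]
    rw [integral_const_mul]
    change _ * mgf id ν (η + t) = _
    rw [← exp_cgf hit, ← Real.exp_add]
    congr 1
    unfold logPartition
    ring

/-- The fourth term of the exponential series of `|δ * y|` is at most the whole series. -/
lemma pow_four_le_exp_add_exp {δ : ℝ} (hδ : 0 < δ) (y : ℝ) :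
    y ^ 4 ≤ 24 / δ ^ 4 * (Real.exp (δ * y) + Real.exp (-δ * y)) := by
  have h1 := Real.pow_div_factorial_le_exp (|δ * y|) (abs_nonneg _) 4
  have h2 : Real.exp |δ * y| ≤ Real.exp (δ * y) + Real.exp (-δ * y) := by
    rcases abs_cases (δ * y) with ⟨h, _⟩ | ⟨h, _⟩ <;> rw [h]
    · linarith [Real.exp_pos (-δ * y)]
    · rw [neg_mul]; linarith [Real.exp_pos (δ * y)]
  have h3 : |δ * y| ^ 4 = δ ^ 4 * y ^ 4 := by
    rw [← mul_pow, ← abs_pow, abs_of_nonneg (by positivity)]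
  rw [h3] at h1
  rw [show ((Nat.factorial 4 : ℕ) : ℝ) = 24 by norm_num [Nat.factorial]] at h1
  rw [div_mul_eq_mul_div, le_div_iff₀ (by positivity)]
  linarith

/-- Fourth central moments are bounded over a closed interval of bounded variance. -/
lemma exists_fourth_moment_bound {I : Set ℝ} (hI_closed : IsClosed I) (hI_conv : I.OrdConnected)
    (hI_nat : I ⊆ naturalInterior ν) {V : ℝ} (hV : ∀ η ∈ I, variance id (expFamily ν η) ≤ V) :
    ∃ K, ∀ η ∈ I, ∫ a, (a - invLink ν η) ^ 4 ∂(expFamily ν η) ≤ K := by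
  rcases eq_zero_or_neZero ν with rfl | hν
  · exact ⟨0, by simp [expFamily]⟩
  obtain ⟨δ, hδ, H⟩ := exists_bound_thickening_of_closed_interval (isOpen_naturalInterior ν)
    (continuousOn_variance_expFamily ν) hI_nat hI_closed hI_conv hV
  -- The left side is the log moment generating function at `t` of the centred variable.
  have hmgf : ∀ η ∈ I, ∀ t, |t| = δ → η + t ∈ naturalInterior ν ∧
      logPartition ν (η + t) - logPartition ν η - t * invLink ν η ≤ (V + 1) * δ ^ 2 := by
    intro η hη t ht
    have hmem : ∀ y ∈ Set.uIcc η (η + t), y ∈ naturalInterior ν ∧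
        variance id (expFamily ν y) ≤ V + 1 := fun y hy => by
      have h1 := Set.abs_sub_left_of_mem_uIcc hy
      have := H η hη (y - η) (by rw [← ht]; simpa using h1)
      simpa using this
    refine ⟨(hmem _ Set.right_mem_uIcc).1, ?_⟩
    have := taylor_one_le (b := logPartition ν) (b' := invLink ν)
      (b'' := fun y => variance id (expFamily ν y)) (u := η) (v := η + t) (V := V + 1)
      (fun y hy => hasDerivAt_logPartition (hmem y hy).1)
      (fun y hy => hasDerivAt_invLink (hmem y hy).1)
      (fun y hy => variance_nonneg _ _) (fun y hy => (hmem y hy).2)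
    rw [add_sub_cancel_left, ← sq_abs t, ht] at this
    linarith
  refine ⟨24 / δ ^ 4 * (2 * Real.exp ((V + 1) * δ ^ 2)), fun η hη => ?_⟩
  obtain ⟨m1, l1⟩ := hmgf η hη δ (abs_of_pos hδ)
  obtain ⟨m2, l2⟩ := hmgf η hη (-δ) (by rw [abs_neg, abs_of_pos hδ])
  obtain ⟨i1, e1⟩ := exp_mul_sub_integrable_expFamily (hI_nat hη) m1 (invLink ν η)
  obtain ⟨i2, e2⟩ := exp_mul_sub_integrable_expFamily (hI_nat hη) m2 (invLink ν η)
  calc _ ≤ ∫ a, 24 / δ ^ 4 * (Real.exp (δ * (a - invLink ν η))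
        + Real.exp (-δ * (a - invLink ν η))) ∂(expFamily ν η) := by
        refine integral_mono_of_nonneg (ae_of_all _ fun a => by positivity)
          ((i1.add i2).const_mul _) (ae_of_all _ fun a => pow_four_le_exp_add_exp hδ _)
    _ = 24 / δ ^ 4 * (Real.exp (logPartition ν (η + δ) - logPartition ν η - δ * invLink ν η)
        + Real.exp (logPartition ν (η + -δ) - logPartition ν η - -δ * invLink ν η)) := by
        rw [integral_const_mul, integral_add i1 i2, e1, e2]
    _ ≤ _ := by
        rw [two_mul]
        gcongr

/-- The squared difference of means is controlled by the Kullback–Leibler-type divergence. -/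
lemma sq_invLink_sub_le {I : Set ℝ} (hI_conv : I.OrdConnected)
    (hI_nat : I ⊆ naturalInterior ν) {V : ℝ} (hV : ∀ η ∈ I, variance id (expFamily ν η) ≤ V)
    {u v : ℝ} (hu : u ∈ I) (hv : v ∈ I) :
    (invLink ν v - invLink ν u) ^ 2
      ≤ 2 * V * (logPartition ν v - logPartition ν u - invLink ν u * (v - u)) :=
  have hsub : Set.uIcc u v ⊆ I := hI_conv.uIcc_subset hu hv
  sq_deriv_sub_le (b'' := fun y => variance id (expFamily ν y))
    (fun _ hy => hasDerivAt_logPartition (hI_nat (hsub hy)))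
    (fun _ hy => hasDerivAt_invLink (hI_nat (hsub hy)))
    (fun _ _ => variance_nonneg _ _) (fun _ hy => hV _ (hsub hy))

end ExponentialFamily


/-! ### Nuclear norm duality. -/

section NuclearNorm

variable {n : ℕ}

/-- The trace pairing of two matrices can be computed along any orthonormal basis. -/
lemma sum_mul_eq_sum_inner (M N : Matrix (Fin n) (Fin n) ℝ)
    (v : OrthonormalBasis (Fin n) ℝ (EuclideanSpace ℝ (Fin n))) :
    ∑ i, ∑ j, M i j * N i j
      = ∑ k, inner ℝ (Matrix.toEuclideanLin M (v k)) (Matrix.toEuclideanLin N (v k)) := by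
  have h : ∀ k, inner ℝ (Matrix.toEuclideanLin M (v k)) (Matrix.toEuclideanLin N (v k))
      = ∑ i, inner ℝ (WithLp.toLp 2 (M i)) (v k) * inner ℝ (v k) (WithLp.toLp 2 (N i)) := by
    intro k
    simp only [PiLp.inner_apply, Matrix.toLpLin_apply, Matrix.mulVec, dotProduct,
      RCLike.inner_apply, conj_trivial]
    refine Finset.sum_congr rfl fun i _ => ?_
    rw [mul_comm]
    congr 1; exact Finset.sum_congr rfl fun j _ => by ring
  symm
  simp_rw [h]
  rw [Finset.sum_comm]
  refine Finset.sum_congr rfl fun i _ => ?_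
  rw [v.sum_inner_mul_inner]
  simp [PiLp.inner_apply, mul_comm]

/-- An orthonormal basis of right singular vectors. -/
lemma exists_orthonormalBasis_norm_eq_singularValues (M : Matrix (Fin n) (Fin n) ℝ) :
    ∃ v : OrthonormalBasis (Fin n) ℝ (EuclideanSpace ℝ (Fin n)),
      ∀ k, ‖Matrix.toEuclideanLin M (v k)‖ = (Matrix.toEuclideanLin M).singularValues k := by
  set T := Matrix.toEuclideanLin M
  have hn : Module.finrank ℝ (EuclideanSpace ℝ (Fin n)) = n := by simp
  refine ⟨T.isSymmetric_adjoint_comp_self.eigenvectorBasis hn, fun k => ?_⟩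
  set w := T.isSymmetric_adjoint_comp_self.eigenvectorBasis hn k with hw
  rw [← sq_eq_sq₀ (norm_nonneg _) (T.singularValues_nonneg _), T.sq_singularValues_fin hn,
    ← real_inner_self_eq_norm_sq, ← LinearMap.adjoint_inner_right]
  change inner ℝ w ((LinearMap.adjoint T ∘ₗ T) w) = _
  rw [hw, T.isSymmetric_adjoint_comp_self.apply_eigenvectorBasis hn k, inner_smul_right,
    real_inner_self_eq_norm_sq, OrthonormalBasis.norm_eq_one]
  simp

/-- The left side is the pairing of `NᵀN` with the unit-norm matrix `w wᵀ`; apply Cauchy–Schwarz.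
The Frobenius norm of the Gram matrix is convenient because its square is a polynomial in the
entries, with computable expectation. -/
lemma norm_toEuclideanLin_sq_le (N : Matrix (Fin n) (Fin n) ℝ)
    (w : EuclideanSpace ℝ (Fin n)) (hw : ‖w‖ = 1) :
    ‖Matrix.toEuclideanLin N w‖ ^ 2 ≤ √(∑ j, ∑ l, (∑ i, N i j * N i l) ^ 2) := by
  have hw2 : ∑ j, w j ^ 2 = 1 := by
    have := EuclideanSpace.norm_sq_eq w
    simpa [hw] using this.symm
  have e : ‖Matrix.toEuclideanLin N w‖ ^ 2
      = ∑ p : Fin n × Fin n, (∑ i, N i p.1 * N i p.2) * (w p.1 * w p.2) := by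
    rw [EuclideanSpace.norm_sq_eq, Fintype.sum_prod_type]
    simp only [Matrix.toLpLin_apply, Matrix.mulVec, dotProduct, Real.norm_eq_abs, sq_abs]
    simp_rw [sq, Finset.sum_mul_sum, Finset.sum_mul]
    rw [Finset.sum_comm]
    refine Finset.sum_congr rfl fun j _ => ?_
    rw [Finset.sum_comm]
    exact Finset.sum_congr rfl fun l _ => Finset.sum_congr rfl fun i _ => by ring
  refine Real.le_sqrt_of_sq_le ?_
  rw [e]
  refine (Finset.sum_mul_sq_le_sq_mul_sq _ _ _).trans ?_
  have h1 : ∑ p : Fin n × Fin n, (w p.1 * w p.2) ^ 2 = 1 := by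
    simp_rw [Fintype.sum_prod_type, mul_pow, ← Finset.mul_sum, hw2, mul_one]
    exact hw2
  rw [h1, mul_one, Fintype.sum_prod_type]

/-- Duality between the nuclear norm and (a bound for) the operator norm. -/
lemma abs_sum_mul_le_nuclearNorm_mul (M N : Matrix (Fin n) (Fin n) ℝ) :
    |∑ i, ∑ j, M i j * N i j|
      ≤ nuclearNorm M * √(√(∑ j, ∑ l, (∑ i, N i j * N i l) ^ 2)) := by
  obtain ⟨v, hv⟩ := exists_orthonormalBasis_norm_eq_singularValues M
  rw [sum_mul_eq_sum_inner M N v, nuclearNorm,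
    ← Fin.sum_univ_eq_sum_range (fun k => (Matrix.toEuclideanLin M).singularValues k),
    Finset.sum_mul]
  refine (Finset.abs_sum_le_sum_abs _ _).trans (Finset.sum_le_sum fun k _ => ?_)
  refine (abs_real_inner_le_norm _ _).trans ?_
  rw [hv]
  exact mul_le_mul_of_nonneg_left
    (Real.le_sqrt_of_sq_le (norm_toEuclideanLin_sq_le N _ (v.norm_eq_one k)))
    (LinearMap.singularValues_nonneg _ _)

lemma nuclearNorm_nonneg (M : Matrix (Fin n) (Fin n) ℝ) : 0 ≤ nuclearNorm M :=
  Finset.sum_nonneg fun _ _ => LinearMap.singularValues_nonneg _ _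

/-- Cauchy–Schwarz over the nonzero singular values, whose squares sum to the squared Frobenius
norm. -/
lemma nuclearNorm_le_sqrt_rank_mul_frobNorm (M : Matrix (Fin n) (Fin n) ℝ) :
    nuclearNorm M ≤ √(M.rank : ℝ) * frobNorm M := by
  obtain ⟨v, hv⟩ := exists_orthonormalBasis_norm_eq_singularValues M
  set σ := (Matrix.toEuclideanLin M).singularValues
  have hrank : Module.finrank ℝ (Matrix.toEuclideanLin M).range = M.rank := by
    rw [Matrix.rank_eq_finrank_range_toLin M (EuclideanSpace.basisFun (Fin n) ℝ).toBasis
      (EuclideanSpace.basisFun (Fin n) ℝ).toBasis, Matrix.toEuclideanLin_eq_toLin_orthonormal]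
  have hsupp : σ.support = Finset.range M.rank := by
    rw [← hrank]; exact LinearMap.support_singularValues _
  have hle : M.rank ≤ n := by simpa using M.rank_le_width
  have h1 : nuclearNorm M = ∑ k ∈ Finset.range M.rank, 1 * σ k := by
    simp only [one_mul]
    refine (Finset.sum_subset (Finset.range_mono hle) fun k _ hk => ?_).symm
    rwa [← hsupp, Finsupp.notMem_support_iff] at hk
  have h2 : ∑ i, ∑ j, M i j ^ 2 = ∑ k ∈ Finset.range n, σ k ^ 2 := by
    simp_rw [sq, sum_mul_eq_sum_inner M M v, real_inner_self_eq_norm_mul_norm, hv]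
    exact Fin.sum_univ_eq_sum_range (fun k => σ k * σ k) n
  rw [h1, frobNorm, h2, ← Real.sqrt_mul (Nat.cast_nonneg _)]
  refine Real.le_sqrt_of_sq_le ((Finset.sum_mul_sq_le_sq_mul_sq _ _ _).trans ?_)
  simp only [one_pow, Finset.sum_const, Finset.card_range, nsmul_eq_mul, mul_one]
  gcongr

lemma frobNorm_le_of_abs_le {M : Matrix (Fin n) (Fin n) ℝ} {K : ℝ} (hK : 0 ≤ K)
    (h : ∀ i j, |M i j| ≤ K) : frobNorm M ≤ n * K := by
  refine Real.sqrt_le_iff.2 ⟨by positivity, ?_⟩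
  calc ∑ i, ∑ j, M i j ^ 2 ≤ ∑ _i : Fin n, ∑ _j : Fin n, K ^ 2 :=
        Finset.sum_le_sum fun i _ => Finset.sum_le_sum fun j _ =>
          sq_le_sq.2 ((h i j).trans (le_abs_self K))
    _ = _ := by simp; ring

end NuclearNorm


/-! ### Second moments of linear and Gram functionals of a noise matrix. -/

section RandomMatrix

variable {Ω : Type*} [MeasurableSpace Ω] {μ : Measure Ω}

variable {n : ℕ} {E : Ω → Matrix (Fin n) (Fin n) ℝ}

lemma memLp_two_mul {f g : Ω → ℝ} (hf : MemLp f 4 μ) (hg : MemLp g 4 μ) :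
    MemLp (fun ω => f ω * g ω) 2 μ := by
  have : ENNReal.HolderTriple 4 4 2 := ⟨by
    rw [← two_mul, show (4 : ENNReal) = 2 * 2 by norm_num,
      ENNReal.mul_inv (by norm_num) (by norm_num), ← mul_assoc,
      ENNReal.mul_inv_cancel (by norm_num) (by norm_num), one_mul]⟩
  exact hg.mul hf

lemma memLp_two_gram (hL4 : ∀ i j, MemLp (fun ω => E ω i j) 4 μ) (j l : Fin n) :
    MemLp (fun ω => ∑ i, E ω i j * E ω i l) 2 μ :=
  memLp_finsetSum _ fun i _ => memLp_two_mul (hL4 i j) (hL4 i l)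

variable [IsProbabilityMeasure μ]

lemma integral_sq_sum_of_pairwise_indepFun {ι : Type*} {s : Finset ι} {X : ι → Ω → ℝ}
    (hX : ∀ i ∈ s, MemLp (X i) 2 μ) (h0 : ∀ i ∈ s, ∫ ω, X i ω ∂μ = 0)
    (hind : Set.Pairwise (s : Set ι) fun i j => IndepFun (X i) (X j) μ) :
    ∫ ω, (∑ i ∈ s, X i ω) ^ 2 ∂μ = ∑ i ∈ s, ∫ ω, X i ω ^ 2 ∂μ := by
  have h := IndepFun.variance_sum hX hind
  have hs : MemLp (fun ω => ∑ i ∈ s, X i ω) 2 μ := memLp_finsetSum s hX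
  rw [Finset.sum_fn, variance_of_integral_eq_zero hs.aestronglyMeasurable.aemeasurable
    (by rw [integral_finsetSum _ fun i hi => (hX i hi).integrable (by norm_num),
      Finset.sum_eq_zero h0])] at h
  rw [h]
  exact Finset.sum_congr rfl fun i hi =>
    variance_of_integral_eq_zero (hX i hi).aestronglyMeasurable.aemeasurable (h0 i hi)

lemma integral_sq_weighted_sum_le
    (hind : iIndepFun (fun (p : Fin n × Fin n) ω => E ω p.1 p.2) μ)
    (hL2 : ∀ i j, MemLp (fun ω => E ω i j) 2 μ) (h0 : ∀ i j, ∫ ω, E ω i j ∂μ = 0)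
    {V : ℝ} (hV : ∀ i j, ∫ ω, E ω i j ^ 2 ∂μ ≤ V) (w : Fin n → Fin n → ℝ) {W : ℝ}
    (hw : ∀ i j, w i j ^ 2 ≤ W) :
    ∫ ω, (∑ i, ∑ j, w i j * E ω i j) ^ 2 ∂μ ≤ n ^ 2 * (W * V) := by
  have h := integral_sq_sum_of_pairwise_indepFun (μ := μ) (s := Finset.univ)
    (X := fun (p : Fin n × Fin n) ω => w p.1 p.2 * E ω p.1 p.2)
    (fun p _ => (hL2 p.1 p.2).const_mul _)
    (fun p _ => by rw [integral_const_mul, h0, mul_zero])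
    (fun p _ q _ hpq => (hind.indepFun hpq).comp (φ := fun y => w p.1 p.2 * y)
      (ψ := fun y => w q.1 q.2 * y) (by fun_prop) (by fun_prop))
  simp_rw [Fintype.sum_prod_type] at h
  rw [h]
  calc _ ≤ ∑ _i : Fin n, ∑ _j : Fin n, W * V := by
        refine Finset.sum_le_sum fun i _ => Finset.sum_le_sum fun j _ => ?_
        simp_rw [mul_pow]
        rw [integral_const_mul]
        exact mul_le_mul (hw i j) (hV i j) (integral_nonneg fun ω => sq_nonneg _)
          ((sq_nonneg _).trans (hw i j))
    _ = _ := by simp; ring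

/-- Each off-diagonal Gram entry is a sum of `n` uncorrelated centred terms, with second moment
`O(n)`; there are at most `n²` of them. The `n` diagonal entries are not centred and have second
moment `O(n²)`. Both groups total `O(n³)`. -/
lemma integral_sq_gram_le (hind : iIndepFun (fun (p : Fin n × Fin n) ω => E ω p.1 p.2) μ)
    (hL4 : ∀ i j, MemLp (fun ω => E ω i j) 4 μ) (h0 : ∀ i j, ∫ ω, E ω i j ∂μ = 0)
    {V K : ℝ} (hV : ∀ i j, ∫ ω, E ω i j ^ 2 ∂μ ≤ V) (hK : ∀ i j, ∫ ω, E ω i j ^ 4 ∂μ ≤ K)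
    (hV0 : 0 ≤ V) :
    ∫ ω, (∑ j, ∑ l, (∑ i, E ω i j * E ω i l) ^ 2) ∂μ ≤ n ^ 3 * (V ^ 2 + K) := by
  have hae : ∀ p : Fin n × Fin n, AEMeasurable (fun ω => E ω p.1 p.2) μ :=
    fun p => (hL4 p.1 p.2).aestronglyMeasurable.aemeasurable
  have hint : ∀ j l, Integrable (fun ω => (∑ i, E ω i j * E ω i l) ^ 2) μ :=
    fun j l => (memLp_two_gram hL4 j l).integrable_sq
  have hoff : ∀ j l, j ≠ l → ∫ ω, (∑ i, E ω i j * E ω i l) ^ 2 ∂μ ≤ n * V ^ 2 := by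
    intro j l hjl
    have hjl' : ∀ i, IndepFun (fun ω => E ω i j) (fun ω => E ω i l) μ := fun i =>
      hind.indepFun (i := (i, j)) (j := (i, l)) (by simp [hjl])
    rw [integral_sq_sum_of_pairwise_indepFun (X := fun i ω => E ω i j * E ω i l)
      (fun i _ => memLp_two_mul (hL4 i j) (hL4 i l))]
    · calc _ ≤ ∑ _i : Fin n, V ^ 2 := by
            refine Finset.sum_le_sum fun i _ => ?_
            simp_rw [mul_pow]
            have := ((hjl' i).comp (φ := fun y => y ^ 2) (ψ := fun y => y ^ 2)
              (by fun_prop) (by fun_prop)).integral_fun_mul_eq_mul_integral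
              ((hae (i, j)).pow_const 2).aestronglyMeasurable
              ((hae (i, l)).pow_const 2).aestronglyMeasurable
            simp only [Function.comp_apply] at this
            rw [this, sq V]
            exact mul_le_mul (hV i j) (hV i l) (integral_nonneg fun ω => sq_nonneg _) hV0
        _ = _ := by simp
    · intro i _
      rw [(hjl' i).integral_fun_mul_eq_mul_integral
        (hae (i, j)).aestronglyMeasurable (hae (i, l)).aestronglyMeasurable, h0, zero_mul]
    · intro i _ k _ hik
      -- Products from different rows share no entry of the matrix.
      exact hind.indepFun_mul_mul₀ hae (i, j) (i, l) (k, j) (k, l)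
        (by simp [hik]) (by simp [hik]) (by simp [hik]) (by simp [hik])
  have hdiag : ∀ j, ∫ ω, (∑ i, E ω i j * E ω i j) ^ 2 ∂μ ≤ n ^ 2 * K := by
    intro j
    have hi4 : ∀ i, Integrable (fun ω => E ω i j ^ 4) μ := fun i => by
      have := (memLp_two_mul (hL4 i j) (hL4 i j)).integrable_sq
      exact this.congr (ae_of_all _ fun ω => by ring)
    calc _ ≤ ∫ ω, n * ∑ i, E ω i j ^ 4 ∂μ := by
          refine integral_mono (hint j j)
            ((integrable_finsetSum _ fun i _ => hi4 i).const_mul _) fun ω => ?_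
          have := sq_sum_le_card_mul_sum_sq (s := Finset.univ) (f := fun i => E ω i j * E ω i j)
          simp only [Finset.card_univ, Fintype.card_fin] at this
          refine this.trans_eq ?_
          congr 1
          exact Finset.sum_congr rfl fun i _ => by ring
      _ = n * ∑ i, ∫ ω, E ω i j ^ 4 ∂μ := by
          rw [integral_const_mul, integral_finsetSum _ fun i _ => hi4 i]
      _ ≤ n * ∑ _i : Fin n, K := by gcongr with i; exact hK i j
      _ = _ := by simp; ring
  have hone : ∀ j l : Fin n, ∫ ω, (∑ i, E ω i j * E ω i l) ^ 2 ∂μ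
      ≤ n * V ^ 2 + if j = l then n ^ 2 * K else 0 := by
    intro j l
    split_ifs with h
    · subst h
      exact (hdiag j).trans (le_add_of_nonneg_left (by positivity))
    · simpa using hoff j l h
  rw [integral_finsetSum _ fun j _ => integrable_finsetSum _ fun l _ => hint j l]
  calc _ = ∑ j, ∑ l, ∫ ω, (∑ i, E ω i j * E ω i l) ^ 2 ∂μ :=
        Finset.sum_congr rfl fun j _ => integral_finsetSum _ fun l _ => hint j l
    _ ≤ ∑ j : Fin n, ∑ l : Fin n, (n * V ^ 2 + if j = l then (n : ℝ) ^ 2 * K else 0) :=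
        Finset.sum_le_sum fun j _ => Finset.sum_le_sum fun l _ => hone j l
    _ = _ := by simp [Finset.sum_add_distrib]; ring

end RandomMatrix


/-! ### The deterministic error bound for the maximizer. -/

section BasicInequality

variable {n m : ℕ}

lemma linPred_apply (x : Fin n → Fin n → EuclideanSpace ℝ (Fin m))
    (Θ : Matrix (Fin n) (Fin n) ℝ) (β : EuclideanSpace ℝ (Fin m)) (i j : Fin n) :
    linPred x Θ β i j = Θ i j + ∑ k, β k * x i j k := by
  simp [linPred, Matrix.add_apply, Matrix.sum_apply]

lemma sum_linPred_mul (x : Fin n → Fin n → EuclideanSpace ℝ (Fin m))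
    (Θ : Matrix (Fin n) (Fin n) ℝ) (β : EuclideanSpace ℝ (Fin m))
    (N : Matrix (Fin n) (Fin n) ℝ) :
    ∑ i, ∑ j, linPred x Θ β i j * N i j
      = ∑ i, ∑ j, Θ i j * N i j + ∑ k, β k * ∑ i, ∑ j, x i j k * N i j := by
  simp_rw [linPred_apply, add_mul, Finset.sum_add_distrib, Finset.sum_mul, Finset.mul_sum]
  congr 1
  symm
  rw [Finset.sum_comm]
  refine Finset.sum_congr rfl fun i _ => ?_
  rw [Finset.sum_comm]
  exact Finset.sum_congr rfl fun j _ => Finset.sum_congr rfl fun k _ => by ring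

/-- Linear predictors pair with a noise matrix `N` at the scale of `N`'s Gram matrix and of the
scores in the directions of the covariates. -/
lemma abs_sum_linPred_mul_le (x : Fin n → Fin n → EuclideanSpace ℝ (Fin m))
    {Θ : Matrix (Fin n) (Fin n) ℝ} {β : EuclideanSpace ℝ (Fin m)}
    (N : Matrix (Fin n) (Fin n) ℝ) {R B : ℝ} (hR : nuclearNorm Θ ≤ R) (hB : ‖β‖ ≤ B) :
    |∑ i, ∑ j, linPred x Θ β i j * N i j|
      ≤ R * √(√(∑ j, ∑ l, (∑ i, N i j * N i l) ^ 2))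
        + B * ∑ k, |∑ i, ∑ j, x i j k * N i j| := by
  rw [sum_linPred_mul]
  refine (abs_add_le _ _).trans (add_le_add ?_ ?_)
  · exact (abs_sum_mul_le_nuclearNorm_mul Θ N).trans
      (mul_le_mul_of_nonneg_right hR (Real.sqrt_nonneg _))
  · refine (Finset.abs_sum_le_sum_abs _ _).trans ?_
    rw [Finset.mul_sum]
    refine Finset.sum_le_sum fun k _ => ?_
    rw [abs_mul]
    exact mul_le_mul_of_nonneg_right ((PiLp.norm_apply_le β k).trans hB) (abs_nonneg _)

/-- The basic inequality for a maximizer `q` of the likelihood against a feasible `q₀`. -/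
lemma frobNorm_sq_fittedMean_sub_le {ν : Measure ℝ} {I : Set ℝ} (hI_conv : I.OrdConnected)
    (hI_nat : I ⊆ naturalInterior ν) {V : ℝ} (hV : ∀ η ∈ I, variance id (expFamily ν η) ≤ V)
    (hV0 : 0 ≤ V) {R B : ℝ} {s : ℕ} {x : Fin n → Fin n → EuclideanSpace ℝ (Fin m)}
    {A : Matrix (Fin n) (Fin n) ℝ} {q q₀ : Matrix (Fin n) (Fin n) ℝ × EuclideanSpace ℝ (Fin m)}
    (hq : IsEstimate ν I R s B x A q) (hq₀ : q₀ ∈ feasibleSet I R s B x)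
    {N : Matrix (Fin n) (Fin n) ℝ} (hN : N = A - fittedMean ν x q₀) :
    frobNorm (fittedMean ν x q - fittedMean ν x q₀) ^ 2
      ≤ 4 * V * (R * √(√(∑ j, ∑ l, (∑ i, N i j * N i l) ^ 2))
        + B * ∑ k, |∑ i, ∑ j, x i j k * N i j|) := by
  obtain ⟨hqf, hmax⟩ := hq
  have hlik : logLik ν x A q₀ ≤ logLik ν x A q := hmax hq₀
  have h1 := abs_sum_linPred_mul_le x N hqf.1 hqf.2.2.1
  have h2 := abs_sum_linPred_mul_le x N hq₀.1 hq₀.2.2.1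
  set T := R * √(√(∑ j, ∑ l, (∑ i, N i j * N i l) ^ 2))
        + B * ∑ k, |∑ i, ∑ j, x i j k * N i j|
  set η := linPred x q.1 q.2
  set η₀ := linPred x q₀.1 q₀.2
  have hNij : ∀ i j, N i j = A i j - invLink ν (η₀ i j) := fun i j => by
    rw [hN]; rfl
  have hfrob : frobNorm (fittedMean ν x q - fittedMean ν x q₀) ^ 2
      = ∑ i, ∑ j, (invLink ν (η i j) - invLink ν (η₀ i j)) ^ 2 := by
    exact Real.sq_sqrt (Finset.sum_nonneg fun i _ => Finset.sum_nonneg fun j _ => sq_nonneg _)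
  -- Substituting `A = N + b'(η₀)` in the likelihood comparison turns its linear part into the
  -- divergence.
  have hdiv : ∑ i, ∑ j, (logPartition ν (η i j) - logPartition ν (η₀ i j)
      - invLink ν (η₀ i j) * (η i j - η₀ i j))
      ≤ ∑ i, ∑ j, η i j * N i j - ∑ i, ∑ j, η₀ i j * N i j := by
    rw [← sub_nonneg] at hlik ⊢
    refine hlik.trans_eq ?_
    simp only [logLik, ← Finset.sum_sub_distrib]
    refine Finset.sum_congr rfl fun i _ => Finset.sum_congr rfl fun j _ => ?_
    rw [hNij]
    ring
  rw [hfrob]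
  calc _ ≤ ∑ i, ∑ j, 2 * V * (logPartition ν (η i j) - logPartition ν (η₀ i j)
          - invLink ν (η₀ i j) * (η i j - η₀ i j)) :=
        Finset.sum_le_sum fun i _ => Finset.sum_le_sum fun j _ =>
          sq_invLink_sub_le hI_conv hI_nat hV (hq₀.2.2.2 i j) (hqf.2.2.2 i j)
    _ = 2 * V * ∑ i, ∑ j, (logPartition ν (η i j) - logPartition ν (η₀ i j)
          - invLink ν (η₀ i j) * (η i j - η₀ i j)) := by simp_rw [Finset.mul_sum]
    -- One `T` for each of `q` and `q₀`, which satisfy the same constraints.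
    _ ≤ 2 * V * (T + T) := by
        refine mul_le_mul_of_nonneg_left (hdiv.trans ?_) (by positivity)
        linarith [(abs_le.1 h1).2, (abs_le.1 h2).1]
    _ = _ := by ring

lemma mem_feasibleSet_of_abs_le {I : Set ℝ} {R B Kθ : ℝ} {r s : ℕ}
    {x : Fin n → Fin n → EuclideanSpace ℝ (Fin m)} {Θ : Matrix (Fin n) (Fin n) ℝ}
    {β : EuclideanSpace ℝ (Fin m)} (hK : 0 ≤ Kθ) (hΘ : ∀ i j, |Θ i j| ≤ Kθ) (hr : Θ.rank ≤ r)
    (hs : r ≤ s) (hR : √(r : ℝ) * n * Kθ ≤ R) (hβ : ‖β‖ ≤ B)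
    (hη : ∀ i j, linPred x Θ β i j ∈ I) : (Θ, β) ∈ feasibleSet I R s B x := by
  refine ⟨?_, hr.trans hs, hβ, hη⟩
  refine (nuclearNorm_le_sqrt_rank_mul_frobNorm Θ).trans (le_trans ?_ hR)
  rw [mul_assoc]
  have := frobNorm_le_of_abs_le hK hΘ
  gcongr
  exact Real.sqrt_nonneg _

/-- Conversion of a small (normalized) fourth-order noise functional into a small error. -/
lemma noise_bound_of_normalized_le {ρ C B : ℝ} (hρ0 : 0 < ρ) (hρ1 : ρ ≤ 1) (hn : 0 < n)
    {R G : ℝ} (hB : 0 ≤ B) (hR0 : 0 ≤ R) (hR : R ≤ C * n) {S : Fin m → ℝ} (hG : 0 ≤ G)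
    (hT : (G + ∑ k, S k ^ 2) / n ^ 4 ≤ ρ ^ 4) :
    R * √(√G) + B * ∑ k, |S k| ≤ n ^ 2 * ((C + B * m) * ρ) := by
  have hn' : (0 : ℝ) < n := by exact_mod_cast hn
  rw [div_le_iff₀ (by positivity)] at hT
  have hS0 : 0 ≤ ∑ k, S k ^ 2 := Finset.sum_nonneg fun _ _ => sq_nonneg _
  have h1 : √(√G) ≤ ρ * n := by
    refine Real.sqrt_le_iff.2 ⟨by positivity, Real.sqrt_le_iff.2 ⟨by positivity, ?_⟩⟩
    linarith [show ((ρ * n) ^ 2) ^ 2 = ρ ^ 4 * n ^ 4 by ring]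
  have h2 : ∀ k, |S k| ≤ n ^ 2 * ρ := fun k => by
    have h3 : S k ^ 2 ≤ ∑ k, S k ^ 2 :=
      Finset.single_le_sum (f := fun k => S k ^ 2) (fun _ _ => sq_nonneg _) (Finset.mem_univ k)
    have h4 : |S k| ≤ ρ ^ 2 * n ^ 2 := by
      refine abs_le_of_sq_le_sq ?_ (by positivity)
      linarith [show (ρ ^ 2 * (n : ℝ) ^ 2) ^ 2 = ρ ^ 4 * n ^ 4 by ring]
    -- The scores come out at scale `ρ ^ 2`; `ρ ≤ 1` brings them to the scale `ρ` of the spectral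
    -- term.
    have h5 : ρ ^ 2 ≤ ρ := by nlinarith
    calc |S k| ≤ ρ ^ 2 * n ^ 2 := h4
      _ ≤ ρ * n ^ 2 := by gcongr
      _ = _ := mul_comm _ _
  calc R * √(√G) + B * ∑ k, |S k| ≤ C * n * (ρ * n) + B * ∑ _k : Fin m, n ^ 2 * ρ := by
        gcongr with k
        · exact hR0.trans hR
        · exact h2 k
    _ = _ := by simp; ring

end BasicInequality

/-! ### Moments of the centred observations. -/

section Noise

variable {n m : ℕ} {ν : Measure ℝ} {I : Set ℝ}

lemma meanMatrix_eq_fittedMean {Ω : Type*} [MeasurableSpace Ω] {μ : Measure Ω}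
    (hI_nat : I ⊆ naturalInterior ν) {x : Fin n → Fin n → EuclideanSpace ℝ (Fin m)}
    {q : Matrix (Fin n) (Fin n) ℝ × EuclideanSpace ℝ (Fin m)}
    (hη : ∀ i j, linPred x q.1 q.2 i j ∈ I) {A : Ω → Matrix (Fin n) (Fin n) ℝ}
    (hA : ∀ i j, HasLaw (fun ω => A ω i j) (expFamily ν (linPred x q.1 q.2 i j)) μ) :
    meanMatrix μ A = fittedMean ν x q := by
  ext i j
  exact (hA i j).integral_eq.trans (integral_expFamily (hI_nat (hη i j)))

/-- Expectation of the fourth-order noise functional. -/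
lemma integral_noise_le {Ω : Type*} [MeasurableSpace Ω] {μ : Measure Ω} [IsProbabilityMeasure μ]
    (hI_nat : I ⊆ naturalInterior ν) {V K Kx : ℝ} (hV0 : 0 ≤ V)
    (hV : ∀ η ∈ I, variance id (expFamily ν η) ≤ V)
    (hK : ∀ η ∈ I, ∫ a, (a - invLink ν η) ^ 4 ∂(expFamily ν η) ≤ K)
    {x : Fin n → Fin n → EuclideanSpace ℝ (Fin m)} (hx : ∀ i j, ‖x i j‖ ≤ Kx)
    {η : Matrix (Fin n) (Fin n) ℝ} (hη : ∀ i j, η i j ∈ I) {A : Ω → Matrix (Fin n) (Fin n) ℝ}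
    (hA : ∀ i j, HasLaw (fun ω => A ω i j) (expFamily ν (η i j)) μ)
    (hind : iIndepFun (fun (p : Fin n × Fin n) ω => A ω p.1 p.2) μ)
    {E : Ω → Matrix (Fin n) (Fin n) ℝ} (hE : ∀ ω, E ω = A ω - η.map (invLink ν)) :
    Integrable (fun ω => ∑ j, ∑ l, (∑ i, E ω i j * E ω i l) ^ 2
      + ∑ k, (∑ i, ∑ j, x i j k * E ω i j) ^ 2) μ ∧
    ∫ ω, (∑ j, ∑ l, (∑ i, E ω i j * E ω i l) ^ 2
      + ∑ k, (∑ i, ∑ j, x i j k * E ω i j) ^ 2) ∂μ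
      ≤ n ^ 3 * (V ^ 2 + K) + m * (n ^ 2 * (Kx ^ 2 * V)) := by
  have hEij : ∀ i j, (fun ω => E ω i j) = fun ω => A ω i j - invLink ν (η i j) :=
    fun i j => by ext ω; rw [hE]; rfl
  have hA4 : ∀ i j, MemLp (fun ω => A ω i j) 4 μ := fun i j => by
    have := memLp_expFamily (hI_nat (hη i j)) 4
    rw [← (hA i j).map_eq] at this
    exact this.comp_of_map (hA i j).aemeasurable
  have hL4 : ∀ i j, MemLp (fun ω => E ω i j) 4 μ := fun i j => by
    rw [hEij]; exact (hA4 i j).sub (memLp_const _)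
  have hL2 : ∀ i j, MemLp (fun ω => E ω i j) 2 μ := fun i j =>
    (hL4 i j).mono_exponent (by norm_num)
  have hmean : ∀ i j, ∫ ω, A ω i j ∂μ = invLink ν (η i j) := fun i j =>
    (hA i j).integral_eq.trans (integral_expFamily (hI_nat (hη i j)))
  have h0 : ∀ i j, ∫ ω, E ω i j ∂μ = 0 := fun i j => by
    rw [hEij, integral_sub ((hA4 i j).integrable (by norm_num)) (integrable_const _), hmean]
    simp
  have hV' : ∀ i j, ∫ ω, E ω i j ^ 2 ∂μ ≤ V := fun i j => by
    have h := (hA i j).variance_eq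
    rw [variance_eq_integral (hA i j).aemeasurable, hmean] at h
    simp_rw [fun ω => congrFun (hEij i j) ω]
    rw [h]
    exact hV _ (hη i j)
  have hK' : ∀ i j, ∫ ω, E ω i j ^ 4 ∂μ ≤ K := fun i j => by
    have h := (hA i j).integral_comp (f := fun a => (a - invLink ν (η i j)) ^ 4)
      (by fun_prop)
    simp_rw [fun ω => congrFun (hEij i j) ω]
    exact h.trans_le (hK _ (hη i j))
  have hindE : iIndepFun (fun (p : Fin n × Fin n) ω => E ω p.1 p.2) μ := by
    have := hind.comp (fun p y => y - invLink ν (η p.1 p.2)) (fun p => by fun_prop)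
    convert this using 2 with p
    exact hEij p.1 p.2
  have i1 : Integrable (fun ω => ∑ j, ∑ l, (∑ i, E ω i j * E ω i l) ^ 2) μ :=
    integrable_finsetSum _ fun j _ => integrable_finsetSum _ fun l _ =>
      (memLp_two_gram hL4 j l).integrable_sq
  have i2 : ∀ k ∈ Finset.univ, Integrable (fun ω => (∑ i, ∑ j, x i j k * E ω i j) ^ 2) μ :=
    fun k _ => (memLp_finsetSum _ fun i _ => memLp_finsetSum _ fun j _ =>
      (hL2 i j).const_mul _).integrable_sq
  refine ⟨i1.add (integrable_finsetSum _ i2), ?_⟩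
  rw [integral_add i1 (integrable_finsetSum _ i2), integral_finsetSum _ i2]
  refine add_le_add (integral_sq_gram_le hindE hL4 h0 hV' hK' hV0) ?_
  calc _ ≤ ∑ _k : Fin m, (n : ℝ) ^ 2 * (Kx ^ 2 * V) :=
        Finset.sum_le_sum fun k _ => integral_sq_weighted_sum_le hindE hL2 h0 hV'
          (fun i j => x i j k) fun i j => by
            rw [sq_le_sq]
            exact ((PiLp.norm_apply_le (x i j) k).trans (hx i j)).trans (le_abs_self _)
    _ = _ := by simp

end Noise

end LowRankGLM

/-! ### Convergence in probability by Markov's inequality. -/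

open LowRankGLM in
theorem corollary1
    -- the exponential family, and the closed interval of linear predictors that is considered
    (ν : Measure ℝ) (I : Set ℝ) (hI_closed : IsClosed I) (hI_conv : I.OrdConnected)
    (hI_nat : I ⊆ naturalInterior ν)
    (V : ℝ) (hV : ∀ η ∈ I, variance id (expFamily ν η) ≤ V)
    -- constants and tuning parameters
    {m : ℕ} (r : ℕ) (Kθ Kβ Kx B C : ℝ) (hB : Kβ ≤ B)
    (s : ℕ → ℕ) (hs : ∀ n, r ≤ s n)
    (R : ℕ → ℝ) (hR_lower : ∀ n : ℕ, √(r : ℝ) * n * Kθ ≤ R n) (hR_upper : ∀ n : ℕ, R n ≤ C * n)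
    -- true parameters and covariates, for each number of nodes `n`
    (Θ : (n : ℕ) → Matrix (Fin n) (Fin n) ℝ) (β : ℕ → EuclideanSpace ℝ (Fin m))
    (x : (n : ℕ) → Fin n → Fin n → EuclideanSpace ℝ (Fin m))
    (hΘ_max : ∀ n i j, |Θ n i j| ≤ Kθ) (hΘ_rank : ∀ n, (Θ n).rank ≤ r)
    (hβ : ∀ n, ‖β n‖ ≤ Kβ) (hx : ∀ n i j, ‖x n i j‖ ≤ Kx)
    (hη : ∀ n i j, linPred (x n) (Θ n) (β n) i j ∈ I)
    -- the observed network: independent edges with the law given by the model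
    {Ω : ℕ → Type*} [∀ n, MeasurableSpace (Ω n)] (μ : (n : ℕ) → Measure (Ω n))
    [∀ n, IsProbabilityMeasure (μ n)]
    (A : (n : ℕ) → Ω n → Matrix (Fin n) (Fin n) ℝ)
    (hA_law : ∀ n i j,
      HasLaw (fun ω => A n ω i j) (expFamily ν (linPred (x n) (Θ n) (β n) i j)) (μ n))
    (hA_indep : ∀ n, iIndepFun (fun (p : Fin n × Fin n) ω => A n ω p.1 p.2) (μ n))
    -- the estimator: any maximizer of the log-likelihood over the feasible set
    (est : (n : ℕ) → Ω n → Matrix (Fin n) (Fin n) ℝ × EuclideanSpace ℝ (Fin m))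
    (hest : ∀ n, ∀ᵐ ω ∂(μ n), IsEstimate ν I (R n) (s n) B (x n) (A n ω) (est n ω)) :
    ∀ ε > 0, Tendsto (fun n : ℕ => μ n {ω |
        ε ≤ (n : ℝ)⁻¹ * frobNorm (fittedMean ν (x n) (est n ω) - meanMatrix (μ n) (A n))})
      atTop (𝓝 0) := by
  intro ε hε
  obtain ⟨K, hK⟩ := exists_fourth_moment_bound hI_closed hI_conv hI_nat hV
  have hB0 : 0 ≤ B := ((norm_nonneg _).trans (hβ 0)).trans hB
  obtain ⟨ρ, hρ0, hρ1, hρε⟩ : ∃ ρ : ℝ, 0 < ρ ∧ ρ ≤ 1 ∧ 4 * V * (C + B * m) * ρ < ε ^ 2 := by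
    set D := 4 * V * (C + B * m)
    -- `|D| + 1` keeps the denominator positive whatever the sign of `D`.
    refine ⟨min 1 (ε ^ 2 / (|D| + 1)), by positivity, min_le_left _ _, ?_⟩
    have h0 : 0 < min 1 (ε ^ 2 / (|D| + 1)) := by positivity
    calc D * min 1 (ε ^ 2 / (|D| + 1)) < (|D| + 1) * min 1 (ε ^ 2 / (|D| + 1)) :=
          mul_lt_mul_of_pos_right (by linarith [le_abs_self D]) h0
      _ ≤ (|D| + 1) * (ε ^ 2 / (|D| + 1)) := by gcongr; exact min_le_right _ _
      _ = ε ^ 2 := by field_simp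
  set M := (V ^ 2 + K) + m * (Kx ^ 2 * V)
  have hlim : Tendsto (fun n : ℕ => ENNReal.ofReal (M / ρ ^ 4 / (n : ℝ))) atTop (𝓝 0) := by
    have := ENNReal.tendsto_ofReal (tendsto_const_div_atTop_nhds_zero_nat (M / ρ ^ 4))
    simpa using this
  refine tendsto_of_tendsto_of_tendsto_of_le_of_le' tendsto_const_nhds hlim
    (Eventually.of_forall fun _ => zero_le) ?_
  -- An entry must exist for the signs of `V` and `Kθ` to be read off.
  filter_upwards [eventually_gt_atTop 0] with n hn
  have hn' : (0 : ℝ) < n := by exact_mod_cast hn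
  have hn1 : (1 : ℝ) ≤ n := by exact_mod_cast hn
  have hV0 : 0 ≤ V := (variance_nonneg _ _).trans (hV _ (hη n ⟨0, hn⟩ ⟨0, hn⟩))
  have hKθ : 0 ≤ Kθ := (abs_nonneg _).trans (hΘ_max n ⟨0, hn⟩ ⟨0, hn⟩)
  have hfeas := mem_feasibleSet_of_abs_le hKθ (hΘ_max n) (hΘ_rank n) (hs n) (hR_lower n)
    ((hβ n).trans hB) (hη n)
  have hmean : meanMatrix (μ n) (A n) = fittedMean ν (x n) (Θ n, β n) :=
    meanMatrix_eq_fittedMean (q := (Θ n, β n)) hI_nat (hη n) (hA_law n)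
  set E : Ω n → Matrix (Fin n) (Fin n) ℝ := fun ω => A n ω - fittedMean ν (x n) (Θ n, β n)
  obtain ⟨hint, hle⟩ := integral_noise_le hI_nat hV0 hV hK (hx n) (hη n) (hA_law n) (hA_indep n)
    (E := E) fun ω => rfl
  set T : Ω n → ℝ := fun ω => ∑ j, ∑ l, (∑ i, E ω i j * E ω i l) ^ 2
      + ∑ k, (∑ i, ∑ j, x n i j k * E ω i j) ^ 2 with hTdef
  have hT0 : ∀ ω, 0 ≤ T ω := fun ω => by positivity
  have hsub : {ω | ε ≤ (n : ℝ)⁻¹ * frobNorm (fittedMean ν (x n) (est n ω)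
      - meanMatrix (μ n) (A n))} ≤ᵐ[μ n] {ω | n ^ 4 * ρ ^ 4 ≤ T ω} := by
    filter_upwards [hest n] with ω hω hε'
    change ε ≤ _ at hε'
    change _ ≤ T ω
    -- A small `T` would force `(ε n)² ≤ 4 V (C + B m) ρ n² < ε² n²`.
    by_contra! hlt
    rw [hmean, inv_mul_eq_div, le_div_iff₀ hn'] at hε'
    have h1 := frobNorm_sq_fittedMean_sub_le hI_conv hI_nat hV hV0 hω hfeas (N := E ω) rfl
    have h2 := noise_bound_of_normalized_le (C := C) hρ0 hρ1 hn hB0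
      ((nuclearNorm_nonneg _).trans hfeas.1) (hR_upper n)
      (G := ∑ j, ∑ l, (∑ i, E ω i j * E ω i l) ^ 2)
      (S := fun k => ∑ i, ∑ j, x n i j k * E ω i j) (by positivity)
      (by rw [div_le_iff₀ (by positivity), mul_comm]; exact hlt.le)
    have h3 : (ε * n) ^ 2 ≤ 4 * V * (n ^ 2 * ((C + B * m) * ρ)) :=
      ((pow_le_pow_left₀ (by positivity) hε' 2).trans h1).trans
        (mul_le_mul_of_nonneg_left h2 (by positivity))
    nlinarith [mul_lt_mul_of_pos_right hρε (show (0 : ℝ) < n ^ 2 by positivity)]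
  refine (measure_mono_ae hsub).trans ?_
  have hmarkov := mul_meas_ge_le_integral_of_nonneg (ae_of_all _ hT0) hint ((n : ℝ) ^ 4 * ρ ^ 4)
  rw [← ofReal_measureReal]
  refine ENNReal.ofReal_le_ofReal ?_
  -- The `n²` score term is absorbed using `n ≥ 1`; dividing by the threshold `n⁴ ρ⁴` leaves the
  -- rate `1 / n`.
  have hbound : ∫ ω, T ω ∂(μ n) ≤ n ^ 3 * M := by
    refine hle.trans ?_
    have : (n : ℝ) ^ 2 ≤ n ^ 3 := pow_le_pow_right₀ hn1 (by norm_num)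
    have h5 : (0 : ℝ) ≤ m * (Kx ^ 2 * V) := by positivity
    nlinarith [mul_le_mul_of_nonneg_right this h5]
  rw [div_div, le_div_iff₀ (by positivity)]
  have h6 := hmarkov.trans hbound
  have h7 : (n : ℝ) ^ 3 * ((μ n).real {ω | n ^ 4 * ρ ^ 4 ≤ T ω} * (ρ ^ 4 * n)) ≤ n ^ 3 * M := by
    refine le_trans (le_of_eq ?_) h6
    ring
  exact le_of_mul_le_mul_left h7 (by positivity)
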